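/- Let $p$ be a prime and let $q=p^f$ be an odd prime power; let $r\ge 2$ be an integer. Let $\mathfrak f_{r,2}(\mathbb F_q)$ be the free nilpotent $\mathbb F_q$-Lie algebra of class $2$ on $r$ generators, i.e. the quotient of the free $\mathbb F_q$-Lie algebra $L$ on $r$ generators by $[L,[L,L]]$. Let $F_{r,2}(\mathbb F_q)=\exp(\mathfrak f_{r,2}(\mathbb F_q))$ be the finite $p$-group with underlying set $\mathfrak f_{r,2}(\mathbb F_q)$ and with multiplication given by the Hausdorff series, $u\star v=u+v+\tfrac12[u,v]$. For a finite $p$-group $G$ and $m\ge 0$ let $\mathrm{ch}_m(G)$ be the number of irreducible complex characters of $G$ of degree $p^m$. Then the set of degrees of the irreducible complex characters of $F_{r,2}(\mathbb F_q)$ is $\{1,q,q^2,\dots,q^{\lfloor r/2\rfloor}\}$, and for every integer $i$ with $0\le 2i\le r$, $$\mathrm{ch}_{if}(F_{r,2}(\mathbb F_q))=q^{r+i^2-3i}\,\frac{\prod_{j=0}^{2i-1}\bigl(q^{r-j}-1\bigr)}{\prod_{j=0}^{i-1}\bigl(q^{2(i-j)}-1\bigr)}.$$ -/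

import Mathlib

/-- The free nilpotent Lie algebra of class `c` on `r` generators over `K`: the free Lie algebra
modulo the `(c + 1)`-st term of its lower central series. (In the indexing used here,
`lowerCentralSeries K L L 0 = L` and `lowerCentralSeries K L L 1 = ⁅L, L⁆`.) -/
def FreeNilpotentLieAlgebra (K : Type*) [Field K] (r c : ℕ) :=
  FreeLieAlgebra K (Fin r) ⧸
    LieModule.lowerCentralSeries K (FreeLieAlgebra K (Fin r)) (FreeLieAlgebra K (Fin r)) c

noncomputable instance (K : Type*) [Field K] (r c : ℕ) : LieRing (FreeNilpotentLieAlgebra K r c) :=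
  inferInstanceAs (LieRing (FreeLieAlgebra K (Fin r) ⧸
    LieModule.lowerCentralSeries K (FreeLieAlgebra K (Fin r)) (FreeLieAlgebra K (Fin r)) c))

noncomputable instance (K : Type*) [Field K] (r c : ℕ) :
    LieAlgebra K (FreeNilpotentLieAlgebra K r c) :=
  inferInstanceAs (LieAlgebra K (FreeLieAlgebra K (Fin r) ⧸
    LieModule.lowerCentralSeries K (FreeLieAlgebra K (Fin r)) (FreeLieAlgebra K (Fin r)) c))

/-- The underlying set of `exp(𝔣)`, where `𝔣` is the free nilpotent Lie algebra of class `2` on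
`r` generators over `K`; the maps `exp` and `log` are the identity of `𝔣`. -/
@[ext]
structure FreeNilpotentGroupTwo (K : Type*) [Field K] (r : ℕ) where
  exp ::
  log : FreeNilpotentLieAlgebra K r 2

namespace FreeNilpotentLieAlgebra

/-- Threefold brackets vanish in the free nilpotent Lie algebra of class `2`. -/
theorem lie_lie_eq_zero {K : Type*} [Field K] {r : ℕ} (x y z : FreeNilpotentLieAlgebra K r 2) :
    ⁅x, ⁅y, z⁆⁆ = 0 := by
  obtain ⟨a, rfl⟩ := LieSubmodule.Quotient.surjective_mk' _ x
  obtain ⟨b, rfl⟩ := LieSubmodule.Quotient.surjective_mk' _ y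
  obtain ⟨c, rfl⟩ := LieSubmodule.Quotient.surjective_mk' _ z
  have h : ⁅a, ⁅b, c⁆⁆ ∈ LieModule.lowerCentralSeries K (FreeLieAlgebra K (Fin r))
      (FreeLieAlgebra K (Fin r)) 2 := by
    rw [LieModule.lowerCentralSeries_succ, LieModule.lowerCentralSeries_succ]
    exact LieSubmodule.lie_mem_lie (LieSubmodule.mem_top a)
      (LieSubmodule.lie_mem_lie (LieSubmodule.mem_top b) (LieSubmodule.mem_top c))
  exact (LieSubmodule.Quotient.mk_eq_zero (N := LieModule.lowerCentralSeries K
    (FreeLieAlgebra K (Fin r)) (FreeLieAlgebra K (Fin r)) 2)).2 h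

theorem lie_lie_eq_zero' {K : Type*} [Field K] {r : ℕ} (x y z : FreeNilpotentLieAlgebra K r 2) :
    ⁅⁅x, y⁆, z⁆ = 0 := by
  rw [← lie_skew, lie_lie_eq_zero, neg_zero]

end FreeNilpotentLieAlgebra

namespace FreeNilpotentGroupTwo

variable {K : Type*} [Field K] {r : ℕ}

/-- The Hausdorff product: in class `2` the Hausdorff series is `u + v + (1/2)[u, v]`. -/
noncomputable instance : Mul (FreeNilpotentGroupTwo K r) :=
  ⟨fun u v => exp (u.log + v.log + (2⁻¹ : K) • ⁅u.log, v.log⁆)⟩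

noncomputable instance : One (FreeNilpotentGroupTwo K r) := ⟨exp 0⟩

noncomputable instance : Inv (FreeNilpotentGroupTwo K r) := ⟨fun u => exp (-u.log)⟩

theorem log_mul (u v : FreeNilpotentGroupTwo K r) :
    (u * v).log = u.log + v.log + (2⁻¹ : K) • ⁅u.log, v.log⁆ := rfl

theorem log_one : (1 : FreeNilpotentGroupTwo K r).log = 0 := rfl

theorem log_inv (u : FreeNilpotentGroupTwo K r) : (u⁻¹).log = -u.log := rfl

/-- The group `F_{r,2}(K) = exp(𝔣_{r,2}(K))` for a field `K` with `2 ≠ 0`. (The group axioms for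
the product above do not need `2 ≠ 0`, so this is not required by the instance.) -/
noncomputable instance : Group (FreeNilpotentGroupTwo K r) :=
  Group.ofLeftAxioms
    (fun u v w => by
      ext
      simp only [log_mul, add_lie, lie_add, smul_lie, lie_smul,
        FreeNilpotentLieAlgebra.lie_lie_eq_zero, FreeNilpotentLieAlgebra.lie_lie_eq_zero',
        smul_zero, add_zero, smul_add]
      abel)
    (fun u => by
      ext
      simp only [log_mul, log_one, zero_lie, smul_zero, add_zero, zero_add])
    (fun u => by
      ext
      simp only [log_mul, log_one, log_inv, neg_lie, lie_self, neg_zero, smul_zero, add_zero,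
        neg_add_cancel])

end FreeNilpotentGroupTwo

/-- `χ` is a complex irreducible character of `G`: the character of an irreducible
finite-dimensional complex representation. -/
def IsIrreducibleCharacter (G : Type*) [Group G] (χ : G → ℂ) : Prop :=
  ∃ (d : ℕ) (ρ : Representation ℂ G (Fin d → ℂ)), ρ.IsIrreducible ∧ χ = ρ.character

/-- The set of irreducible complex characters of `G` of degree `n`. -/
def irreducibleCharactersOfDegree (G : Type*) [Group G] (n : ℕ) : Set (G → ℂ) :=
  {χ | IsIrreducibleCharacter G χ ∧ χ 1 = (n : ℂ)}

/-- The set of character degrees of `G`. -/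
def characterDegrees (G : Type*) [Group G] : Set ℕ :=
  {n | (irreducibleCharactersOfDegree G n).Nonempty}

/-- `characterVector p G i` is the number of irreducible complex characters of `G` of
degree `p ^ i`. -/
noncomputable def characterVector (p : ℕ) (G : Type*) [Group G] (i : ℕ) : ℕ :=
  (irreducibleCharactersOfDegree G (p ^ i)).ncard

/-!
The proof is Kirillov's orbit method for the class-`2` group `G = exp(L)`, where
`L = FreeNilpotentLieAlgebra K r 2` and `q = |K|` is odd. Fix a nontrivial additive character `ψ`
of `K`. A functional `m` on `L` gives an alternating form `(x, y) ↦ m ⁅x, y⁆` with radical `R`,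
and every irreducible representation `ρ` satisfies `ρ (exp x) = ψ (m x)` on `R` for some `m`
(`exists_liesOver`): Schur's lemma gives such an `m` on the centre of `L`, after which the elements
of `R` commute with the whole group in the image of `ρ`, and Schur's lemma applies once more.
Conversely, every `m` occurs, in the representation induced from `exp R`
(`exists_isIrreducible_liesOver`).

The character of such a `ρ` vanishes off `R`, as an element outside `R` is conjugate to a multiple
of itself by an element acting as a scalar other than `1`. Since the character has norm `1`, the
square of the degree is `|L| / |R| = q ^ (2 i)`, where `2 i` is the rank of the alternating matrix
`m ⁅xᵢ, xⱼ⁆` on the generators (`LiesOver.finrank_sq`). So irreducible characters correspond to the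
cosets `m + Rᗮ` of functionals, each of size `q ^ (2 i)`, where `Rᗮ` is the annihilator of `R`
(`card_kirillovCharacter_eq`).

Functionals on `L` are pairs of a vector in `Kʳ` and an alternating `r × r` matrix (`dualEquiv`),
so it remains to count alternating matrices by rank. Bordering an alternating matrix `A` of size
`n` by a vector `v` preserves the rank if `v` is in the column space of `A` and raises it by `2`
otherwise, which gives the recursion
`N(n + 1, k + 2) = q ^ (k + 2) N(n, k + 2) + (q ^ n - q ^ k) N(n, k)`
(`numAlternating_succ_add_two`). Its solution is `numAlternating_even`; odd ranks do not occur.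
-/

/-! ### Alternating matrices of given rank -/

/-- The alternating `n × n` matrices over `K`: skew-symmetric with zero diagonal. -/
def alternatingMatrices (K : Type*) [Field K] (n : ℕ) : Set (Matrix (Fin n) (Fin n) K) :=
  {A | Matrix.transpose A = -A ∧ ∀ i, A i i = 0}

/-- The alternating matrix `[0, v; -vᵀ, A]` obtained by bordering `A` with the vector `v`. -/
def Matrix.border {K : Type*} [Field K] {n : ℕ} (A : Matrix (Fin n) (Fin n) K) (v : Fin n → K) :
    Matrix (Fin (n + 1)) (Fin (n + 1)) K :=
  Matrix.of (Fin.cons (Fin.cons 0 v) fun i => Fin.cons (-v i) (A i))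

section Border

open Matrix

variable {K : Type*} [Field K] {n : ℕ}

theorem Matrix.border_mulVec_cons (A : Matrix (Fin n) (Fin n) K) (v : Fin n → K) (t : K)
    (w : Fin n → K) :
    A.border v *ᵥ Fin.cons t w = Fin.cons (v ⬝ᵥ w) (A *ᵥ w - t • v) := by
  ext i
  refine Fin.cases ?_ (fun i => ?_) i
  · simp [Matrix.border, Matrix.mulVec, dotProduct, Fin.sum_univ_succ]
  · simp [Matrix.border, Matrix.mulVec, dotProduct, Fin.sum_univ_succ]
    ring

theorem Matrix.mem_ker_border_iff (A : Matrix (Fin n) (Fin n) K) (v : Fin n → K)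
    (x : Fin (n + 1) → K) :
    x ∈ LinearMap.ker (A.border v).mulVecLin ↔
      v ⬝ᵥ Fin.tail x = 0 ∧ A *ᵥ Fin.tail x = x 0 • v := by
  rw [LinearMap.mem_ker, Matrix.mulVecLin_apply, ← Fin.cons_self_tail x,
    Matrix.border_mulVec_cons]
  constructor
  · intro h
    exact ⟨by simpa using congrFun h 0, by
      rw [Fin.tail_cons, Fin.cons_zero, ← sub_eq_zero]
      ext i
      simpa using congrFun h i.succ⟩
  · rintro ⟨h1, h2⟩
    rw [Fin.tail_cons] at h1 h2
    rw [h1, h2, Fin.cons_zero, sub_self]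
    ext i
    refine Fin.cases ?_ (fun i => ?_) i <;> simp

theorem Matrix.rank_add_finrank_ker (A : Matrix (Fin n) (Fin n) K) :
    A.rank + Module.finrank K (LinearMap.ker A.mulVecLin) = n := by
  simpa [Matrix.rank] using A.mulVecLin.finrank_range_add_finrank_ker

theorem dotProduct_mulVec_of_transpose_eq_neg {A : Matrix (Fin n) (Fin n) K}
    (hA : Aᵀ = -A) (v w : Fin n → K) : A *ᵥ v ⬝ᵥ w = -(v ⬝ᵥ A *ᵥ w) := by
  rw [Matrix.dotProduct_mulVec, ← Matrix.mulVec_transpose, hA, Matrix.neg_mulVec, neg_dotProduct,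
    neg_neg]

theorem dotProduct_mulVec_self_of_mem_alternatingMatrices {A : Matrix (Fin n) (Fin n) K}
    (hA : A ∈ alternatingMatrices K n) (v : Fin n → K) : v ⬝ᵥ A *ᵥ v = 0 := by
  have hs : ∀ i j, A j i = -A i j := fun i j => congrFun (congrFun hA.1 i) j
  simp only [dotProduct, Matrix.mulVec, Finset.mul_sum]
  rw [← Finset.sum_product']
  -- the terms at `(i, j)` and `(j, i)` cancel, and the diagonal terms vanish
  refine Finset.sum_involution (fun p _ => p.swap) ?_ ?_ (by simp) (by simp)
  · rintro ⟨i, j⟩ -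
    simp only [Prod.swap, hs i j]
    ring
  · rintro ⟨i, j⟩ - h heq
    obtain rfl : j = i := congrArg Prod.fst heq
    exact h (by simp [hA.2])

/-- Bordering by a vector `A u` of the column space adds the kernel vector `(1, u)`. -/
theorem Matrix.rank_border_of_mem {A : Matrix (Fin n) (Fin n) K}
    (hA : A ∈ alternatingMatrices K n) {v : Fin n → K} (hv : v ∈ LinearMap.range A.mulVecLin) :
    (A.border v).rank = A.rank := by
  obtain ⟨u, rfl⟩ := hv
  rw [Matrix.mulVecLin_apply]
  let φ : (K × LinearMap.ker A.mulVecLin) →ₗ[K] (Fin (n + 1) → K) :=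
    { toFun := fun p => Fin.cons p.1 (p.1 • u + (p.2 : Fin n → K))
      map_add' := fun p p' => by
        ext i
        refine Fin.cases ?_ (fun i => ?_) i
        · simp
        · simp
          ring
      map_smul' := fun c p => by
        ext i
        refine Fin.cases ?_ (fun i => ?_) i
        · simp
        · simp
          ring }
  have hinj : Function.Injective φ := by
    intro p p' h
    have h0 : p.1 = p'.1 := by simpa [φ] using congrFun h 0
    refine Prod.ext h0 (Subtype.ext (funext fun i => ?_))
    simpa [φ, h0] using congrFun h i.succ
  have hrange : LinearMap.range φ = LinearMap.ker (A.border (A *ᵥ u)).mulVecLin := by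
    ext x
    rw [Matrix.mem_ker_border_iff, LinearMap.mem_range]
    constructor
    · rintro ⟨⟨t, k, hk⟩, rfl⟩
      have hk' : A *ᵥ k = 0 := hk
      simp only [φ, LinearMap.coe_mk, AddHom.coe_mk, Fin.tail_cons, Fin.cons_zero]
      refine ⟨?_, by rw [Matrix.mulVec_add, Matrix.mulVec_smul, hk', add_zero]⟩
      rw [dotProduct_mulVec_of_transpose_eq_neg hA.1, Matrix.mulVec_add, Matrix.mulVec_smul, hk',
        add_zero, dotProduct_smul, dotProduct_mulVec_self_of_mem_alternatingMatrices hA, smul_zero,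
        neg_zero]
    · rintro ⟨-, h2⟩
      refine ⟨⟨x 0, Fin.tail x - x 0 • u, ?_⟩, ?_⟩
      · rw [LinearMap.mem_ker, Matrix.mulVecLin_apply, Matrix.mulVec_sub, Matrix.mulVec_smul, h2,
          sub_self]
      · simp only [φ, LinearMap.coe_mk, AddHom.coe_mk, add_sub_cancel]
        exact Fin.cons_self_tail x
  have h1 := LinearMap.finrank_range_of_inj hinj
  rw [hrange, Module.finrank_prod, Module.finrank_self] at h1
  have h2 := (A.border (A *ᵥ u)).rank_add_finrank_ker
  have h3 := A.rank_add_finrank_ker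
  omega

/-- Bordering by a vector outside the column space cuts the kernel by one dimension: the column
space of an alternating matrix is the orthogonal complement of its kernel. -/
theorem Matrix.rank_border_of_notMem {A : Matrix (Fin n) (Fin n) K}
    (hA : Aᵀ = -A) {v : Fin n → K} (hv : v ∉ LinearMap.range A.mulVecLin) :
    (A.border v).rank = A.rank + 2 := by
  let δ : LinearMap.ker A.mulVecLin →ₗ[K] K :=
    (dotProductBilin K K v).domRestrict (LinearMap.ker A.mulVecLin)
  have hδ : δ ≠ 0 := by
    -- a functional separating `v` from the column space is the dot product with a kernel vector
    obtain ⟨f, hf, hle⟩ := Submodule.exists_le_ker_of_notMem hv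
    let w : Fin n → K := fun i => f (Pi.single i 1)
    have hfw : ∀ x, f x = w ⬝ᵥ x := fun x => by
      conv_lhs => rw [← LinearMap.sum_single_apply (fun _ => K) x]
      simp only [map_sum, dotProduct, w]
      refine Finset.sum_congr rfl fun i _ => ?_
      rw [← mul_one (x i), ← smul_eq_mul (x i) 1, Pi.single_smul, map_smul, smul_eq_mul, mul_comm]
      simp
    have hw : A *ᵥ w = 0 := by
      refine dotProduct_eq_zero_iff.1 fun x => ?_
      rw [dotProduct_mulVec_of_transpose_eq_neg hA, ← hfw]
      have : f (A *ᵥ x) = 0 := hle ⟨x, rfl⟩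
      rw [this, neg_zero]
    intro h0
    apply hf
    rw [hfw, dotProduct_comm]
    exact congrArg (fun d => d ⟨w, hw⟩) h0
  let φ : LinearMap.ker δ →ₗ[K] (Fin (n + 1) → K) :=
    { toFun := fun p => Fin.cons 0 ((p : LinearMap.ker A.mulVecLin) : Fin n → K)
      map_add' := fun p p' => by
        ext i
        refine Fin.cases ?_ (fun i => ?_) i <;> simp
      map_smul' := fun c p => by
        ext i
        refine Fin.cases ?_ (fun i => ?_) i <;> simp }
  have hinj : Function.Injective φ := by
    intro p p' h
    refine Subtype.ext (Subtype.ext (funext fun i => ?_))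
    simpa [φ] using congrFun h i.succ
  have hrange : LinearMap.range φ = LinearMap.ker (A.border v).mulVecLin := by
    ext x
    rw [Matrix.mem_ker_border_iff, LinearMap.mem_range]
    constructor
    · rintro ⟨⟨⟨k, hk⟩, hk'⟩, rfl⟩
      simp only [φ, LinearMap.coe_mk, AddHom.coe_mk, Fin.tail_cons, Fin.cons_zero, zero_smul]
      exact ⟨hk', hk⟩
    · rintro ⟨h1, h2⟩
      have h0 : x 0 = 0 := by
        by_contra h
        refine hv ⟨(x 0)⁻¹ • Fin.tail x, ?_⟩
        rw [Matrix.mulVecLin_apply, Matrix.mulVec_smul, h2, inv_smul_smul₀ h]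
      rw [h0, zero_smul] at h2
      refine ⟨⟨⟨Fin.tail x, h2⟩, h1⟩, ?_⟩
      simp only [φ, LinearMap.coe_mk, AddHom.coe_mk]
      rw [← h0]
      exact Fin.cons_self_tail x
  have h1 := LinearMap.finrank_range_of_inj hinj
  rw [hrange] at h1
  have h4 := δ.finrank_range_add_finrank_ker
  rw [LinearMap.range_eq_top.2 (LinearMap.surjective hδ), finrank_top, Module.finrank_self] at h4
  have h2 := (A.border v).rank_add_finrank_ker
  have h3 := A.rank_add_finrank_ker
  omega

/-- Every alternating matrix of size `n + 1` is the bordering of a unique alternating matrix of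
size `n` by a unique vector. -/
def alternatingMatricesSuccEquiv :
    alternatingMatrices K (n + 1) ≃ alternatingMatrices K n × (Fin n → K) where
  toFun B := (⟨fun i j => B.1 i.succ j.succ,
      Matrix.ext fun i j => congrFun (congrFun B.2.1 i.succ) j.succ, fun i => B.2.2 i.succ⟩,
    fun j => B.1 0 j.succ)
  invFun p := ⟨p.1.1.border p.2, by
    refine ⟨Matrix.ext fun i j => ?_, fun i => ?_⟩
    · refine Fin.cases ?_ (fun i => ?_) i <;> refine Fin.cases ?_ (fun j => ?_) j
      · simp [Matrix.border]
      · simp [Matrix.border]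
      · simp [Matrix.border]
      · simpa [Matrix.border] using congrFun (congrFun p.1.2.1 i) j
    · refine Fin.cases ?_ (fun i => ?_) i
      · simp [Matrix.border]
      · simpa [Matrix.border] using p.1.2.2 i⟩
  left_inv B := by
    refine Subtype.ext (Matrix.ext fun i j => ?_)
    refine Fin.cases ?_ (fun i => ?_) i <;> refine Fin.cases ?_ (fun j => ?_) j
    · simpa [Matrix.border] using (B.2.2 0).symm
    · simp [Matrix.border]
    · simpa [Matrix.border] using (congrFun (congrFun B.2.1 0) i.succ).symm
    · simp [Matrix.border]
  right_inv p := by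
    refine Prod.ext (Subtype.ext (Matrix.ext fun i j => ?_)) (funext fun j => ?_) <;>
      simp [Matrix.border]

/-- The number of alternating `n × n` matrices of rank `k` over `K`. -/
noncomputable def numAlternating (K : Type*) [Field K] (n k : ℕ) : ℕ :=
  Nat.card {A : alternatingMatrices K n // A.1.rank = k}

theorem numAlternating_eq_card_filter [Fintype (alternatingMatrices K n)] (k : ℕ) :
    numAlternating K n k =
      (Finset.univ.filter fun A : alternatingMatrices K n => A.1.rank = k).card := by
  rw [numAlternating, Nat.card_eq_fintype_card, Fintype.card_subtype]

theorem Matrix.card_range_mulVecLin [Finite K] (A : Matrix (Fin n) (Fin n) K) :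
    Nat.card (LinearMap.range A.mulVecLin) = Nat.card K ^ A.rank :=
  Module.natCard_eq_pow_finrank

/-- Bordering expresses the alternating matrices of rank `k` and size `n + 1` through those of
rank `k` (bordered by the vectors of the column space) and of rank `k - 2` (bordered by the
others). -/
theorem numAlternating_succ_eq [Finite K] (k : ℕ) :
    (numAlternating K (n + 1) k : ℚ) = (Nat.card K : ℚ) ^ k * numAlternating K n k +
      ∑ᶠ A : alternatingMatrices K n,
        if A.1.rank + 2 = k then (Nat.card K : ℚ) ^ n - (Nat.card K : ℚ) ^ A.1.rank else 0 := by
  classical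
  have := Fintype.ofFinite K
  have := Fintype.ofFinite (alternatingMatrices K n)
  have e : {B : alternatingMatrices K (n + 1) // B.1.rank = k} ≃
      Σ A : alternatingMatrices K n, {v : Fin n → K // (A.1.border v).rank = k} :=
    (alternatingMatricesSuccEquiv.subtypeEquiv (q := fun p => (p.1.1.border p.2).rank = k)
      fun B => by
        rw [← Subtype.ext_iff.1 (alternatingMatricesSuccEquiv.left_inv B)]
        rfl).trans
      (Equiv.subtypeProdEquivSigmaSubtype
        fun (A : alternatingMatrices K n) v => (A.1.border v).rank = k)
  have hfib : ∀ A : alternatingMatrices K n,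
      (Nat.card {v : Fin n → K // (A.1.border v).rank = k} : ℚ) =
        (if A.1.rank = k then (Nat.card K : ℚ) ^ k else 0) +
        (if A.1.rank + 2 = k then (Nat.card K : ℚ) ^ n - (Nat.card K : ℚ) ^ A.1.rank else 0) := by
    intro A
    have hiff : ∀ v, (A.1.border v).rank = k ↔
        (v ∈ LinearMap.range A.1.mulVecLin ∧ A.1.rank = k) ∨
        (v ∉ LinearMap.range A.1.mulVecLin ∧ A.1.rank + 2 = k) := by
      intro v
      by_cases hv : v ∈ LinearMap.range A.1.mulVecLin
      · simp only [Matrix.rank_border_of_mem A.2 hv, hv, true_and, not_true, false_and, or_false]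
      · simp only [Matrix.rank_border_of_notMem A.2.1 hv, hv, true_and, not_false_iff, false_and,
          false_or]
    simp only [hiff]
    by_cases h1 : A.1.rank = k
    · have h2 : ¬ k + 2 = k := by omega
      simp only [h1, h2, and_true, and_false, or_false, if_true, if_false, add_zero]
      have hc := A.1.card_range_mulVecLin
      rw [h1] at hc
      exact_mod_cast hc
    · by_cases h2 : A.1.rank + 2 = k
      · simp only [h1, h2, and_true, and_false, false_or, if_true, if_false, zero_add]
        have hc := A.1.card_range_mulVecLin
        have := Fintype.card_subtype_compl fun v => v ∈ LinearMap.range A.1.mulVecLin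
        rw [Nat.card_eq_fintype_card, this, Nat.cast_sub (Fintype.card_subtype_le _)]
        rw [Nat.card_eq_fintype_card] at hc
        simp only [Fintype.card_fun, Fintype.card_fin, Nat.card_eq_fintype_card] at hc ⊢
        rw [hc]
        push_cast
        rfl
      · simp [h1, h2]
  rw [numAlternating, Nat.card_congr e, Nat.card_sigma, finsum_eq_sum_of_fintype]
  push_cast
  simp only [hfib]
  rw [Finset.sum_add_distrib, numAlternating_eq_card_filter, ← Finset.sum_filter, Finset.sum_const,
    nsmul_eq_mul, mul_comm]

theorem numAlternating_succ_of_lt [Finite K] {k : ℕ} (hk : k < 2) :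
    (numAlternating K (n + 1) k : ℚ) = (Nat.card K : ℚ) ^ k * numAlternating K n k := by
  rw [numAlternating_succ_eq]
  have : ∀ A : alternatingMatrices K n, ¬ A.1.rank + 2 = k := fun A => by omega
  simp [this]

theorem numAlternating_succ_add_two [Finite K] (k : ℕ) :
    (numAlternating K (n + 1) (k + 2) : ℚ) =
      (Nat.card K : ℚ) ^ (k + 2) * numAlternating K n (k + 2) +
        ((Nat.card K : ℚ) ^ n - (Nat.card K : ℚ) ^ k) * numAlternating K n k := by
  classical
  have := Fintype.ofFinite (alternatingMatrices K n)
  rw [numAlternating_succ_eq, finsum_eq_sum_of_fintype, ← Finset.sum_filter]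
  simp only [Nat.add_right_cancel_iff]
  rw [Finset.sum_congr rfl (g := fun _ => (Nat.card K : ℚ) ^ n - (Nat.card K : ℚ) ^ k)
      fun A hA => by rw [(Finset.mem_filter.1 hA).2],
    Finset.sum_const, nsmul_eq_mul, numAlternating_eq_card_filter k, mul_comm (Finset.card _ : ℚ)]

theorem numAlternating_zero_zero : numAlternating K 0 0 = 1 := by
  have : Unique {A : alternatingMatrices K 0 // A.1.rank = 0} :=
    { default := ⟨⟨0, by simp, fun i => i.elim0⟩, by simp⟩
      uniq := fun A => Subtype.ext (Subtype.ext (Subsingleton.elim _ _)) }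
  exact Nat.card_unique

theorem numAlternating_zero_succ (k : ℕ) : numAlternating K 0 (k + 1) = 0 := by
  have : IsEmpty {A : alternatingMatrices K 0 // A.1.rank = k + 1} :=
    ⟨fun A => by
      have := A.1.1.rank_le_width
      have := A.2
      omega⟩
  exact Nat.card_of_isEmpty

theorem numAlternating_odd [Finite K] (n i : ℕ) : numAlternating K n (2 * i + 1) = 0 := by
  induction n generalizing i with
  | zero => exact numAlternating_zero_succ _
  | succ n ih =>
    have : (numAlternating K (n + 1) (2 * i + 1) : ℚ) = 0 := by
      cases i with
      | zero => rw [numAlternating_succ_of_lt (by norm_num), ih]; simp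
      | succ i =>
        rw [show 2 * (i + 1) + 1 = (2 * i + 1) + 2 by ring, numAlternating_succ_add_two, ih,
          show 2 * i + 1 + 2 = 2 * (i + 1) + 1 by ring, ih]
        simp
    exact_mod_cast this

/-- The recursion also shows that odd ranks do not occur. -/
theorem even_rank_of_mem_alternatingMatrices [Finite K] {A : Matrix (Fin n) (Fin n) K}
    (hA : A ∈ alternatingMatrices K n) : Even A.rank := by
  by_contra h
  obtain ⟨i, hi⟩ := Nat.not_even_iff_odd.1 h
  have : Nonempty {A : alternatingMatrices K n // A.1.rank = 2 * i + 1} := ⟨⟨⟨A, hA⟩, hi⟩⟩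
  exact Nat.card_pos.ne' (numAlternating_odd (K := K) n i)

theorem prod_range_pow_sub_one_ne_zero {q : ℚ} (hq : 1 < q) (i : ℕ) :
    ∏ j ∈ Finset.range i, (q ^ (2 * (i - j)) - 1) ≠ 0 := by
  refine Finset.prod_ne_zero_iff.2 fun j hj => ?_
  have := Finset.mem_range.1 hj
  exact (sub_pos.2 (one_lt_pow₀ hq (by omega))).ne'

/-- The number of alternating matrices of rank `2 i`; the right-hand side vanishes for `n < 2 i`
because of the factor at `j = n`. -/
theorem numAlternating_even [Finite K] (n i : ℕ) :
    (numAlternating K n (2 * i) : ℚ) = (Nat.card K : ℚ) ^ (i * (i - 1)) *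
      (∏ j ∈ Finset.range (2 * i), ((Nat.card K : ℚ) ^ (n - j) - 1)) /
      (∏ j ∈ Finset.range i, ((Nat.card K : ℚ) ^ (2 * (i - j)) - 1)) := by
  have hq : (1 : ℚ) < Nat.card K := by exact_mod_cast Finite.one_lt_card
  generalize hQ : (Nat.card K : ℚ) = q at hq ⊢
  induction n generalizing i with
  | zero =>
    cases i with
    | zero => simp [numAlternating_zero_zero]
    | succ i =>
      rw [show 2 * (i + 1) = 2 * i + 1 + 1 by ring, numAlternating_zero_succ,
        Finset.prod_range_succ']
      simp
  | succ n ih =>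
    cases i with
    | zero =>
      rw [numAlternating_succ_of_lt (by norm_num), ih]
      simp
    | succ i =>
      rw [show 2 * (i + 1) = 2 * i + 2 by ring, numAlternating_succ_add_two, ih,
        show 2 * i + 2 = 2 * (i + 1) by ring, ih, hQ]
      have hD := prod_range_pow_sub_one_ne_zero hq i
      have hd : q ^ (2 * (i + 1)) - 1 ≠ 0 := (sub_pos.2 (one_lt_pow₀ hq (by omega))).ne'
      have hP : ∏ j ∈ Finset.range (2 * (i + 1)), (q ^ (n + 1 - j) - 1) =
          (∏ j ∈ Finset.range (2 * i), (q ^ (n - j) - 1)) * (q ^ (n - 2 * i) - 1) *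
            (q ^ (n + 1) - 1) := by
        rw [show 2 * (i + 1) = 2 * i + 1 + 1 by ring, Finset.prod_range_succ',
          Finset.prod_range_succ]
        simp only [Nat.add_sub_add_right, Nat.sub_zero]
      have hP' : ∏ j ∈ Finset.range (2 * (i + 1)), (q ^ (n - j) - 1) =
          (∏ j ∈ Finset.range (2 * i), (q ^ (n - j) - 1)) * (q ^ (n - 2 * i) - 1) *
            (q ^ (n - (2 * i + 1)) - 1) := by
        rw [show 2 * (i + 1) = 2 * i + 1 + 1 by ring, Finset.prod_range_succ,
          Finset.prod_range_succ]
      have hDs : ∏ j ∈ Finset.range (i + 1), (q ^ (2 * (i + 1 - j)) - 1) =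
          (∏ j ∈ Finset.range i, (q ^ (2 * (i - j)) - 1)) * (q ^ (2 * (i + 1)) - 1) := by
        rw [Finset.prod_range_succ']
        simp only [Nat.add_sub_add_right, Nat.sub_zero]
      have he : q ^ ((i + 1) * (i + 1 - 1)) = q ^ (i * (i - 1)) * q ^ (2 * i) := by
        rw [← pow_add]
        congr 1
        cases i with
        | zero => rfl
        | succ i => simp only [Nat.add_sub_cancel]; ring
      rw [hP, hP', hDs, he]
      generalize hPP : ∏ j ∈ Finset.range (2 * i), (q ^ (n - j) - 1) = P
      generalize (∏ j ∈ Finset.range i, (q ^ (2 * (i - j)) - 1)) = D at *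
      -- after clearing denominators, what remains is an identity between powers of `q`
      have key : q ^ (2 * i) * (P * (q ^ (n - 2 * i) - 1) * (q ^ (n + 1) - 1)) =
          q ^ (2 * (i + 1)) * q ^ (2 * i) *
            (P * (q ^ (n - 2 * i) - 1) * (q ^ (n - (2 * i + 1)) - 1)) +
          (q ^ n - q ^ (2 * i)) * (q ^ (2 * (i + 1)) - 1) * P := by
        rcases lt_trichotomy n (2 * i) with h | rfl | h
        · have : P = 0 := by
            rw [← hPP]
            exact Finset.prod_eq_zero (Finset.mem_range.2 h) (by simp)
          simp [this]
        · simp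
        · obtain ⟨c, rfl⟩ : ∃ c, n = 2 * i + 1 + c := ⟨n - (2 * i + 1), by omega⟩
          rw [show 2 * i + 1 + c - 2 * i = c + 1 by omega, Nat.add_sub_cancel_left]
          ring
      field_simp
      linear_combination -key

end Border

/-! ### Irreducible representations -/

namespace Representation

variable {G V : Type*} [Group G] [AddCommGroup V] [Module ℂ V] [FiniteDimensional ℂ V]

/-- A nonzero finite-dimensional representation contains an irreducible one, which may be realized
on a space of column vectors. -/
theorem exists_isIrreducible_intertwining [Nontrivial V] (ρ : Representation ℂ G V) :
    ∃ (d : ℕ) (σ : Representation ℂ G (Fin d → ℂ)) (j : (Fin d → ℂ) →ₗ[ℂ] V),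
      σ.IsIrreducible ∧ Function.Injective j ∧ ∀ g v, j (σ g v) = ρ g (j v) := by
  classical
  have hex : ∃ d, ∃ U : Subrepresentation ρ, U.toSubmodule ≠ ⊥ ∧
      Module.finrank ℂ U.toSubmodule = d := ⟨_, ⊤, top_ne_bot, rfl⟩
  -- an invariant subspace of least positive dimension
  obtain ⟨U, hU, hd⟩ := Nat.find_spec hex
  have hmin : ∀ S : Subrepresentation ρ, S.toSubmodule ≠ ⊥ →
      Nat.find hex ≤ Module.finrank ℂ S.toSubmodule := fun S hS => Nat.find_min' hex ⟨S, hS, rfl⟩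
  generalize Nat.find hex = d at hd hmin
  let e : U.toSubmodule ≃ₗ[ℂ] (Fin d → ℂ) := LinearEquiv.ofFinrankEq _ _ (by simp [hd])
  let j : (Fin d → ℂ) →ₗ[ℂ] V := U.toSubmodule.subtype ∘ₗ e.symm.toLinearMap
  have hj : Function.Injective j := U.toSubmodule.injective_subtype.comp e.symm.injective
  let σ : Representation ℂ G (Fin d → ℂ) :=
    { toFun := fun g => e.conj (U.toRepresentation g)
      map_one' := by
        refine LinearMap.ext fun v => ?_
        simp [LinearEquiv.conj_apply]
      map_mul' := fun g h => by
        refine LinearMap.ext fun v => ?_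
        simp [LinearEquiv.conj_apply] }
  have hjσ : ∀ g v, j (σ g v) = ρ g (j v) := fun g v => by
    simp [j, σ, LinearEquiv.conj_apply, Subrepresentation.toRepresentation]
  refine ⟨d, σ, j, ?_, hj, hjσ⟩
  have hdpos : 0 < d := by
    rw [← hd]
    exact Module.finrank_pos_iff.2 (Submodule.nontrivial_iff_ne_bot.2 hU)
  refine
    { exists_pair_ne := ⟨⊥, ⊤, fun h => ?_⟩
      eq_bot_or_eq_top := fun S => ?_ }
  · have h' : (⊥ : Submodule ℂ (Fin d → ℂ)) = ⊤ := congrArg Subrepresentation.toSubmodule h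
    have : Nonempty (Fin d) := ⟨⟨0, hdpos⟩⟩
    exact bot_ne_top h'
  · by_cases hS : S.toSubmodule = ⊥
    · exact Or.inl (Subrepresentation.toSubmodule_injective hS)
    · right
      apply Subrepresentation.toSubmodule_injective
      let S' : Subrepresentation ρ :=
        ⟨S.toSubmodule.map j, by
          rintro g _ ⟨v, hv, rfl⟩
          exact ⟨σ g v, S.apply_mem_toSubmodule g hv, hjσ g v⟩⟩
      have hS' : S'.toSubmodule ≠ ⊥ := fun h =>
        hS (Submodule.map_injective_of_injective hj (h.trans (Submodule.map_bot j).symm))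
      have h1 := hmin S' hS'
      have h2 : Module.finrank ℂ S'.toSubmodule = Module.finrank ℂ S.toSubmodule :=
        (Submodule.equivMapOfInjective j hj S.toSubmodule).finrank_eq.symm
      refine Submodule.eq_top_of_finrank_eq (le_antisymm (Submodule.finrank_le _) ?_)
      rw [← h2, Module.finrank_fin_fun]
      exact h1

theorem IsIrreducible.nontrivial_space {G V : Type*} [Group G] [AddCommGroup V] [Module ℂ V]
    (ρ : Representation ℂ G V) [ρ.IsIrreducible] :
    Nontrivial V := by
  by_contra h
  rw [not_nontrivial_iff_subsingleton] at h
  obtain ⟨S, T, hST⟩ := (inferInstance : Nontrivial (Subrepresentation ρ))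
  exact hST (Subrepresentation.toSubmodule_injective (Subsingleton.elim _ _))

/-- **Schur's lemma**: an endomorphism commuting with an irreducible representation is a scalar. -/
theorem IsIrreducible.exists_eq_smul_one (ρ : Representation ℂ G V) [ρ.IsIrreducible]
    (T : V →ₗ[ℂ] V) (hT : ∀ g, T * ρ g = ρ g * T) : ∃ c : ℂ, T = c • (1 : V →ₗ[ℂ] V) := by
  obtain ⟨c, hc⟩ := (algebraMap_intertwiningMap_bijective_of_isAlgClosed (ρ := ρ)).2
    ⟨T, fun g => hT g⟩
  refine ⟨c, ?_⟩
  have := congrArg IntertwiningMap.toLinearMap hc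
  ext v
  have h := congrArg (fun f : V →ₗ[ℂ] V => f v) this
  exact h.symm

/-- The first orthogonality relation, for a single irreducible character. -/
theorem IsIrreducible.sum_character_mul_character_inv [Fintype G] (ρ : Representation ℂ G V)
    [ρ.IsIrreducible] : ∑ g : G, ρ.character g * ρ.character g⁻¹ = Nat.card G := by
  have hne : (Nat.card G : ℂ) ≠ 0 := by exact_mod_cast Nat.card_pos.ne'
  have : Invertible (Nat.card G : ℂ) := invertibleOfNonzero hne
  have h := char_orthonormal ρ ρ
  rw [if_pos ⟨Equiv.refl ρ⟩, inv_mul_eq_iff_eq_mul₀ hne, mul_one] at h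
  exact h

end Representation

/-! ### Linear functionals on the free nilpotent Lie algebra -/

/-- The Heisenberg-type Lie algebra `Kⁿ ⊕ K` of an alternating matrix `A`, with bracket
`⁅(x, s), (y, t)⁆ = (0, xᵀ A y)`. -/
def HeisenbergLieAlgebra {K : Type*} [Field K] {n : ℕ} (_A : alternatingMatrices K n) :=
  (Fin n → K) × K

namespace HeisenbergLieAlgebra

open Matrix

variable {K : Type*} [Field K] {n : ℕ} (A : alternatingMatrices K n)

instance : AddCommGroup (HeisenbergLieAlgebra A) :=
  inferInstanceAs (AddCommGroup ((Fin n → K) × K))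

instance : Module K (HeisenbergLieAlgebra A) :=
  inferInstanceAs (Module K ((Fin n → K) × K))

instance : Bracket (HeisenbergLieAlgebra A) (HeisenbergLieAlgebra A) :=
  ⟨fun x y => (0, x.1 ⬝ᵥ A.1 *ᵥ y.1)⟩

variable {A}

theorem lie_def (x y : HeisenbergLieAlgebra A) :
    ⁅x, y⁆ = ((0, x.1 ⬝ᵥ A.1 *ᵥ y.1) : (Fin n → K) × K) := rfl

theorem fst_add (x y : HeisenbergLieAlgebra A) : (x + y).1 = x.1 + y.1 := rfl

theorem fst_smul (t : K) (x : HeisenbergLieAlgebra A) : (t • x).1 = t • x.1 := rfl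

theorem lie_eq_zero_of_fst_left {x : HeisenbergLieAlgebra A} (hx : x.1 = 0)
    (y : HeisenbergLieAlgebra A) : ⁅x, y⁆ = 0 := by
  rw [lie_def, hx, zero_dotProduct]
  rfl

theorem lie_eq_zero_of_fst_right (x : HeisenbergLieAlgebra A) {y : HeisenbergLieAlgebra A}
    (hy : y.1 = 0) : ⁅x, y⁆ = 0 := by
  rw [lie_def, hy, mulVec_zero, dotProduct_zero]
  rfl

instance : LieRing (HeisenbergLieAlgebra A) where
  add_lie x y z := by
    rw [lie_def, fst_add, add_dotProduct]
    exact Prod.ext (add_zero _).symm rfl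
  lie_add x y z := by
    rw [lie_def, fst_add, mulVec_add, dotProduct_add]
    exact Prod.ext (add_zero _).symm rfl
  lie_self x := by
    rw [lie_def, dotProduct_mulVec_self_of_mem_alternatingMatrices A.2]
    rfl
  leibniz_lie x y z := by
    rw [lie_eq_zero_of_fst_right x (y := ⁅y, z⁆) rfl,
      lie_eq_zero_of_fst_left (x := ⁅x, y⁆) rfl, lie_eq_zero_of_fst_right y (y := ⁅x, z⁆) rfl,
      add_zero]

instance : LieAlgebra K (HeisenbergLieAlgebra A) where
  lie_smul t x y := by
    rw [lie_def, fst_smul, mulVec_smul, dotProduct_smul]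
    exact Prod.ext (smul_zero _).symm rfl

theorem lie_lie_eq_zero (x y z : HeisenbergLieAlgebra A) : ⁅x, ⁅y, z⁆⁆ = 0 :=
  lie_eq_zero_of_fst_right x rfl

end HeisenbergLieAlgebra

namespace FreeNilpotentLieAlgebra

variable {K : Type*} [Field K] {r : ℕ}

/-- The projection from the free Lie algebra. -/
noncomputable def mkHom (K : Type*) [Field K] (r : ℕ) :
    FreeLieAlgebra K (Fin r) →ₗ⁅K⁆ FreeNilpotentLieAlgebra K r 2 where
  toFun x := (LieSubmodule.Quotient.mk x : FreeLieAlgebra K (Fin r) ⧸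
    LieModule.lowerCentralSeries K (FreeLieAlgebra K (Fin r)) (FreeLieAlgebra K (Fin r)) 2)
  map_add' _ _ := rfl
  map_smul' _ _ := rfl
  map_lie' := rfl

theorem mkHom_surjective : Function.Surjective (mkHom K r) :=
  LieSubmodule.Quotient.surjective_mk' _

theorem mkHom_eq_zero_iff (x : FreeLieAlgebra K (Fin r)) : mkHom K r x = 0 ↔
    x ∈ LieModule.lowerCentralSeries K (FreeLieAlgebra K (Fin r)) (FreeLieAlgebra K (Fin r)) 2 :=
  LieSubmodule.Quotient.mk_eq_zero (N := LieModule.lowerCentralSeries K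
    (FreeLieAlgebra K (Fin r)) (FreeLieAlgebra K (Fin r)) 2)

/-- The free generators. -/
noncomputable def gen (K : Type*) [Field K] {r : ℕ} (i : Fin r) : FreeNilpotentLieAlgebra K r 2 :=
  mkHom K r (FreeLieAlgebra.of K i)

/-- The generators and their brackets span. -/
theorem span_gen_union_lie_gen :
    Submodule.span K (Set.range (gen K (r := r)) ∪
      Set.range fun p : Fin r × Fin r => ⁅gen K p.1, gen K p.2⁆) = ⊤ := by
  set S := Submodule.span K (Set.range (gen K (r := r)) ∪
      Set.range fun p : Fin r × Fin r => ⁅gen K p.1, gen K p.2⁆) with hS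
  have hgen : ∀ i, gen K i ∈ S := fun i => Submodule.subset_span (Or.inl ⟨i, rfl⟩)
  have hlie : ∀ x ∈ S, ∀ y ∈ S, ⁅x, y⁆ ∈ S := by
    intro x hx y hy
    induction hx using Submodule.span_induction with
    | zero => rw [zero_lie]; exact S.zero_mem
    | add a b _ _ ha hb => rw [add_lie]; exact S.add_mem ha hb
    | smul t a _ ha => rw [smul_lie]; exact S.smul_mem t ha
    | mem x hx =>
      induction hy using Submodule.span_induction with
      | zero => rw [lie_zero]; exact S.zero_mem
      | add a b _ _ ha hb => rw [lie_add]; exact S.add_mem ha hb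
      | smul t a _ ha => rw [lie_smul]; exact S.smul_mem t ha
      | mem y hy =>
        rcases hx with ⟨i, rfl⟩ | ⟨p, rfl⟩
        · rcases hy with ⟨j, rfl⟩ | ⟨p, rfl⟩
          · exact Submodule.subset_span (Or.inr ⟨(i, j), rfl⟩)
          · rw [lie_lie_eq_zero]; exact S.zero_mem
        · rw [lie_lie_eq_zero']; exact S.zero_mem
  -- the preimage of the span is a subalgebra of the free Lie algebra containing the generators
  let S' : LieSubalgebra K (FreeLieAlgebra K (Fin r)) :=
    { S.comap (mkHom K r : FreeLieAlgebra K (Fin r) →ₗ[K] FreeNilpotentLieAlgebra K r 2) with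
      lie_mem' := fun {x y} hx hy => by
        change mkHom K r ⁅x, y⁆ ∈ S
        rw [LieHom.map_lie]
        exact hlie _ hx _ hy }
  have hid : S'.incl.comp (FreeLieAlgebra.lift K fun i => (⟨FreeLieAlgebra.of K i, hgen i⟩ : S')) =
      LieHom.id :=
    FreeLieAlgebra.hom_ext fun i => by
      rw [LieHom.comp_apply, FreeLieAlgebra.lift_of_apply]
      rfl
  refine Submodule.eq_top_iff'.2 fun x => ?_
  obtain ⟨a, rfl⟩ := mkHom_surjective x
  have h : S'.incl _ = a := LieHom.congr_fun hid a
  rw [← h]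
  exact Subtype.property (p := fun a => a ∈ S') _

instance : Module.Finite K (FreeNilpotentLieAlgebra K r 2) :=
  Module.finite_def.2 (Submodule.fg_def.2
    ⟨_, (Set.finite_range _).union (Set.finite_range _), span_gen_union_lie_gen⟩)

instance [Finite K] : Finite (FreeNilpotentLieAlgebra K r 2) := Module.finite_of_finite K

theorem gram_mem_alternatingMatrices (m : Module.Dual K (FreeNilpotentLieAlgebra K r 2)) :
    (Matrix.of fun i j => m ⁅gen K i, gen K j⁆) ∈ alternatingMatrices K r :=
  ⟨Matrix.ext fun i j => by
    rw [Matrix.transpose_apply, Matrix.neg_apply, Matrix.of_apply, Matrix.of_apply, ← lie_skew,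
      map_neg],
    fun i => by rw [Matrix.of_apply, lie_self, map_zero]⟩

/-- The alternating matrix `m ⁅xᵢ, xⱼ⁆` of a functional `m`, where the `xᵢ` are the generators. -/
noncomputable def gram (m : Module.Dual K (FreeNilpotentLieAlgebra K r 2)) :
    alternatingMatrices K r :=
  ⟨Matrix.of fun i j => m ⁅gen K i, gen K j⁆, gram_mem_alternatingMatrices m⟩

/-- The values of a functional on the generators and on their brackets can be prescribed. The
functional is found on the Heisenberg-type Lie algebra of `A`, to which the free nilpotent Lie
algebra maps. -/
theorem exists_dual_gen_eq_gram_eq (v : Fin r → K) (A : alternatingMatrices K r) :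
    ∃ m : Module.Dual K (FreeNilpotentLieAlgebra K r 2), (∀ i, m (gen K i) = v i) ∧ gram m = A := by
  let F : FreeLieAlgebra K (Fin r) →ₗ⁅K⁆ HeisenbergLieAlgebra A :=
    FreeLieAlgebra.lift K fun i => (Pi.single i 1, v i)
  have hF : ∀ i, F (FreeLieAlgebra.of K i) = (Pi.single i 1, v i) := fun i =>
    FreeLieAlgebra.lift_of_apply _ _
  have h2 : LieModule.lowerCentralSeries K (FreeLieAlgebra K (Fin r)) (FreeLieAlgebra K (Fin r)) 2
      ≤ F.ker := by
    have h1 : ∀ y ∈ LieModule.lowerCentralSeries K (FreeLieAlgebra K (Fin r))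
        (FreeLieAlgebra K (Fin r)) 1, ∀ x : HeisenbergLieAlgebra A, ⁅x, F y⁆ = 0 := by
      intro y hy x
      rw [LieModule.lowerCentralSeries_succ, ← LieSubmodule.mem_toSubmodule,
        LieSubmodule.lieIdeal_oper_eq_linear_span'] at hy
      induction hy using Submodule.span_induction with
      | zero => rw [map_zero, lie_zero]
      | add a b _ _ ha hb => rw [map_add, lie_add, ha, hb, add_zero]
      | smul t a _ ha => rw [map_smul, lie_smul, ha, smul_zero]
      | mem y hy =>
        obtain ⟨a, -, b, -, rfl⟩ := hy
        rw [LieHom.map_lie, HeisenbergLieAlgebra.lie_lie_eq_zero]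
    rw [LieModule.lowerCentralSeries_succ, LieSubmodule.lie_le_iff]
    intro x _ y hy
    rw [LieHom.mem_ker, LieHom.map_lie, h1 y hy]
  let p : FreeLieAlgebra K (Fin r) →ₗ[K] K :=
    (LinearMap.snd K (Fin r → K) K) ∘ₗ
      (F : FreeLieAlgebra K (Fin r) →ₗ[K] HeisenbergLieAlgebra A)
  have hp : p ∈ LinearMap.range
      (mkHom K r : FreeLieAlgebra K (Fin r) →ₗ[K] FreeNilpotentLieAlgebra K r 2).dualMap := by
    rw [LinearMap.range_dualMap_eq_dualAnnihilator_ker, Submodule.mem_dualAnnihilator]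
    intro x hx
    have hx' : F x = 0 := h2 ((mkHom_eq_zero_iff x).1 hx)
    change (F x).2 = 0
    rw [hx']
    rfl
  obtain ⟨m, hm⟩ := hp
  have hm' : ∀ x, m (mkHom K r x) = (F x).2 := fun x => LinearMap.congr_fun hm x
  refine ⟨m, fun i => ?_, Subtype.ext (Matrix.ext fun i j => ?_)⟩
  · rw [gen, hm', hF]
  · change m ⁅gen K i, gen K j⁆ = A.1 i j
    rw [gen, gen, ← LieHom.map_lie, hm', LieHom.map_lie, HeisenbergLieAlgebra.lie_def, hF, hF]
    simp

/-- Functionals on the free nilpotent Lie algebra of class `2` correspond to pairs of a vector and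
an alternating matrix: their values on the generators and on the brackets of generators. -/
noncomputable def dualEquiv (K : Type*) [Field K] (r : ℕ) :
    Module.Dual K (FreeNilpotentLieAlgebra K r 2) ≃ (Fin r → K) × alternatingMatrices K r :=
  Equiv.ofBijective (fun m => (fun i => m (gen K i), gram m)) (by
    constructor
    · intro m m' h
      have h1 : ∀ i, m (gen K i) = m' (gen K i) := fun i => congrFun (congrArg Prod.fst h) i
      have h2 : ∀ i j, m ⁅gen K i, gen K j⁆ = m' ⁅gen K i, gen K j⁆ := fun i j =>
        congrFun (congrFun (congrArg Subtype.val (congrArg Prod.snd h)) i) j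
      refine LinearMap.ext_on span_gen_union_lie_gen ?_
      rintro _ (⟨i, rfl⟩ | ⟨p, rfl⟩)
      · exact h1 i
      · exact h2 p.1 p.2
    · rintro ⟨v, A⟩
      obtain ⟨m, hm, hA⟩ := exists_dual_gen_eq_gram_eq v A
      exact ⟨m, Prod.ext (funext hm) hA⟩)

theorem card_dual_rank_gram_eq [Finite K] (k : ℕ) :
    Nat.card {m : Module.Dual K (FreeNilpotentLieAlgebra K r 2) // (gram m).1.rank = k} =
      Nat.card K ^ r * numAlternating K r k := by
  have e : {m : Module.Dual K (FreeNilpotentLieAlgebra K r 2) // (gram m).1.rank = k} ≃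
      (Fin r → K) × {A : alternatingMatrices K r // A.1.rank = k} :=
    ((dualEquiv K r).subtypeEquiv (q := fun p => p.2.1.rank = k) fun m => Iff.rfl).trans
      { toFun := fun p => (p.1.1, ⟨p.1.2, p.2⟩)
        invFun := fun p => ⟨(p.1, p.2.1), p.2.2⟩ }
  rw [Nat.card_congr e, Nat.card_prod, Nat.card_fun, Nat.card_fin, numAlternating]

/-- The radical of the alternating form `(x, y) ↦ m ⁅x, y⁆` attached to a functional `m`. -/
def radical (m : Module.Dual K (FreeNilpotentLieAlgebra K r 2)) :
    Submodule K (FreeNilpotentLieAlgebra K r 2) where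
  carrier := {x | ∀ y, m ⁅x, y⁆ = 0}
  zero_mem' y := by rw [zero_lie, map_zero]
  add_mem' {a b} ha hb y := by rw [add_lie, map_add, ha y, hb y, add_zero]
  smul_mem' t a ha y := by rw [smul_lie, map_smul, ha y, smul_zero]

theorem mem_radical {m : Module.Dual K (FreeNilpotentLieAlgebra K r 2)}
    {x : FreeNilpotentLieAlgebra K r 2} : x ∈ radical m ↔ ∀ y, m ⁅x, y⁆ = 0 := Iff.rfl

theorem mem_radical_of_forall_lie_eq_zero {x : FreeNilpotentLieAlgebra K r 2}
    (hx : ∀ y : FreeNilpotentLieAlgebra K r 2, ⁅x, y⁆ = 0)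
    (m : Module.Dual K (FreeNilpotentLieAlgebra K r 2)) : x ∈ radical m :=
  fun y => by rw [hx, map_zero]

theorem lie_mem_radical (m : Module.Dual K (FreeNilpotentLieAlgebra K r 2))
    (x y : FreeNilpotentLieAlgebra K r 2) : ⁅x, y⁆ ∈ radical m :=
  mem_radical_of_forall_lie_eq_zero (lie_lie_eq_zero' x y) m

theorem radical_congr {m m' : Module.Dual K (FreeNilpotentLieAlgebra K r 2)}
    (h : ∀ x y : FreeNilpotentLieAlgebra K r 2, m ⁅x, y⁆ = m' ⁅x, y⁆) : radical m = radical m' :=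
  Submodule.ext fun x => by simp only [mem_radical, h]

theorem gram_congr {m m' : Module.Dual K (FreeNilpotentLieAlgebra K r 2)}
    (h : ∀ x y : FreeNilpotentLieAlgebra K r 2, m ⁅x, y⁆ = m' ⁅x, y⁆) : gram m = gram m' :=
  Subtype.ext (Matrix.ext fun _ _ => h _ _)

/-- The codimension of the radical is the rank of the alternating matrix. -/
theorem finrank_radical_add_rank_gram (m : Module.Dual K (FreeNilpotentLieAlgebra K r 2)) :
    Module.finrank K (radical m) + (gram m).1.rank =
      Module.finrank K (FreeNilpotentLieAlgebra K r 2) := by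
  let T : FreeNilpotentLieAlgebra K r 2 →ₗ[K] (Fin r → K) :=
    { toFun := fun x i => m ⁅x, gen K i⁆
      map_add' := fun x y => by
        ext i
        rw [add_lie, map_add, Pi.add_apply]
      map_smul' := fun t x => by
        ext i
        rw [smul_lie, map_smul, Pi.smul_apply, RingHom.id_apply] }
  have hker : LinearMap.ker T = radical m := by
    ext x
    constructor
    · intro hx y
      have hy : y ∈ Submodule.span K (Set.range (gen K (r := r)) ∪
          Set.range fun p : Fin r × Fin r => ⁅gen K p.1, gen K p.2⁆) := by
        rw [span_gen_union_lie_gen]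
        exact Submodule.mem_top
      induction hy using Submodule.span_induction with
      | zero => rw [lie_zero, map_zero]
      | add a b _ _ ha hb => rw [lie_add, map_add, ha, hb, add_zero]
      | smul t a _ ha => rw [lie_smul, map_smul, ha, smul_zero]
      | mem y hy =>
        rcases hy with ⟨i, rfl⟩ | ⟨p, rfl⟩
        · exact congrFun hx i
        · rw [lie_lie_eq_zero, map_zero]
    · intro hx
      exact funext fun i => hx _
  have hrange : LinearMap.range T = Submodule.span K (Set.range (gram m).1.row) := by
    rw [LinearMap.range_eq_map, ← span_gen_union_lie_gen, Submodule.map_span]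
    apply le_antisymm
    · rw [Submodule.span_le]
      rintro _ ⟨_, ⟨i, rfl⟩ | ⟨p, rfl⟩, rfl⟩
      · exact Submodule.subset_span ⟨i, rfl⟩
      · have : T ⁅gen K p.1, gen K p.2⁆ = 0 :=
          funext fun i => lie_mem_radical m _ _ _
        rw [this]
        exact Submodule.zero_mem _
    · apply Submodule.span_mono
      rintro _ ⟨i, rfl⟩
      exact ⟨gen K i, Or.inl ⟨i, rfl⟩, rfl⟩
  have h := T.finrank_range_add_finrank_ker
  rw [hker, hrange, ← Matrix.rank_eq_finrank_span_row] at h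
  omega

end FreeNilpotentLieAlgebra

/-! ### Additive characters of vector spaces over finite fields -/

section AddChar

variable (K : Type*) [Field K] [Finite K]

/-- A fixed nontrivial additive character of the finite field `K`. -/
noncomputable abbrev stdAddChar : AddChar K ℂ := AddChar.FiniteField.primitiveChar_to_Complex K

variable {K}

theorem eq_zero_of_forall_stdAddChar_mul_eq_one {a : K} (h : ∀ t, stdAddChar K (t * a) = 1) :
    a = 0 := by
  by_contra ha
  refine AddChar.FiniteField.primitiveChar_to_Complex_isPrimitive K ha (DFunLike.ext _ _ fun t => ?_)
  rw [AddChar.mulShift_apply, mul_comm, h, AddChar.one_apply]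

/-- Functionals which agree on a subspace after composition with `stdAddChar` agree on it. -/
theorem eqOn_of_stdAddChar_eqOn {W : Type*} [AddCommGroup W] [Module K W] {p : Submodule K W}
    {m m' : Module.Dual K W} (h : ∀ x ∈ p, stdAddChar K (m x) = stdAddChar K (m' x)) :
    ∀ x ∈ p, m x = m' x := by
  intro x hx
  refine sub_eq_zero.1 (eq_zero_of_forall_stdAddChar_mul_eq_one fun t => ?_)
  rw [mul_sub, ← smul_eq_mul, ← smul_eq_mul, ← map_smul, ← map_smul, AddChar.map_sub_eq_div,
    h _ (p.smul_mem t hx)]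
  exact div_self (AddChar.val_isUnit _ _).ne_zero

/-- Every additive character of a finite-dimensional space over a finite field is the composition
of a functional with `stdAddChar`: there are as many of the one as of the other. -/
theorem exists_dual_of_addChar {W : Type*} [AddCommGroup W] [Module K W] [Module.Finite K W]
    (χ : AddChar W ℂ) : ∃ m : Module.Dual K W, ∀ x, χ x = stdAddChar K (m x) := by
  have : Finite W := Module.finite_of_finite K
  have := Fintype.ofFinite W
  obtain ⟨Φ, hΦ⟩ : ∃ Φ : Module.Dual K W → AddChar W ℂ, ∀ m x, Φ m x = stdAddChar K (m x) :=
    ⟨fun m => (stdAddChar K).compAddMonoidHom m.toAddMonoidHom, fun _ _ => rfl⟩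
  have hinj : Function.Injective Φ := fun m m' h => LinearMap.ext fun x =>
    eqOn_of_stdAddChar_eqOn (p := ⊤) (fun y _ => by rw [← hΦ, ← hΦ, h]) x Submodule.mem_top
  have hcard : Nat.card (AddChar W ℂ) = Nat.card (Module.Dual K W) := by
    rw [Nat.card_eq_fintype_card, AddChar.card_eq, ← Nat.card_eq_fintype_card,
      Module.natCard_eq_pow_finrank (K := K) (V := W),
      Module.natCard_eq_pow_finrank (K := K) (V := Module.Dual K W), Subspace.dual_finrank_eq]
  obtain ⟨m, hm⟩ := (hinj.bijective_of_nat_card_le hcard.le).2 χ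
  exact ⟨m, fun x => by rw [← hm, hΦ]⟩

end AddChar

/-! ### The irreducible representations of `exp(𝔣)` -/

namespace FreeNilpotentGroupTwo

open FreeNilpotentLieAlgebra

variable {K : Type*} [Field K] {r : ℕ}

/-- The bijection underlying `log`. -/
def logEquiv (K : Type*) [Field K] (r : ℕ) :
    FreeNilpotentGroupTwo K r ≃ FreeNilpotentLieAlgebra K r 2 :=
  ⟨log, exp, fun _ => rfl, fun _ => rfl⟩

instance [Finite K] : Finite (FreeNilpotentGroupTwo K r) := Finite.of_equiv _ (logEquiv K r).symm

theorem exp_mul_exp (x y : FreeNilpotentLieAlgebra K r 2) :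
    exp x * exp y = exp (x + y + (2⁻¹ : K) • ⁅x, y⁆) := rfl

theorem exp_mul_exp_of_lie_eq_zero {x y : FreeNilpotentLieAlgebra K r 2} (h : ⁅x, y⁆ = 0) :
    exp x * exp y = exp (x + y) := by
  rw [exp_mul_exp, h, smul_zero, add_zero]

/-- The group commutator is the exponential of the Lie bracket; this needs `2 ≠ 0`. -/
theorem exp_mul_exp_eq_exp_lie_mul (h2 : (2 : K) ≠ 0) (x y : FreeNilpotentLieAlgebra K r 2) :
    exp x * exp y = exp ⁅x, y⁆ * (exp y * exp x) := by
  rw [exp_mul_exp y x, exp_mul_exp_of_lie_eq_zero (lie_lie_eq_zero' _ _ _), exp_mul_exp]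
  congr 1
  have h : -⁅y, x⁆ = -((2⁻¹ : K) • ⁅y, x⁆ + (2⁻¹ : K) • ⁅y, x⁆) := by
    rw [← add_smul, ← two_mul, mul_inv_cancel₀ h2, one_smul]
  rw [← lie_skew x y, smul_neg, h]
  abel

section Finite

variable [Finite K]

/-- The representation `ρ` lies over the functional `m`: on the radical of `m` it acts by the
scalars `ψ (m x)`. -/
def LiesOver {V : Type*} [AddCommGroup V] [Module ℂ V]
    (ρ : Representation ℂ (FreeNilpotentGroupTwo K r) V)
    (m : Module.Dual K (FreeNilpotentLieAlgebra K r 2)) : Prop :=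
  ∀ x ∈ radical m, ρ (exp x) = stdAddChar K (m x) • (1 : V →ₗ[ℂ] V)

/-- If the elements `exp x`, for `x` in a subspace, act on an irreducible representation by
commuting with everything and multiply additively, then they act through a functional. -/
theorem exists_dual_of_commute {V : Type*} [AddCommGroup V] [Module ℂ V] [FiniteDimensional ℂ V]
    (ρ : Representation ℂ (FreeNilpotentGroupTwo K r) V) [ρ.IsIrreducible]
    (W : Submodule K (FreeNilpotentLieAlgebra K r 2))
    (hcomm : ∀ x ∈ W, ∀ g, ρ (exp x) * ρ g = ρ g * ρ (exp x))
    (hadd : ∀ x ∈ W, ∀ y ∈ W, ρ (exp x) * ρ (exp y) = ρ (exp (x + y))) :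
    ∃ m : Module.Dual K (FreeNilpotentLieAlgebra K r 2),
      ∀ x ∈ W, ρ (exp x) = stdAddChar K (m x) • (1 : V →ₗ[ℂ] V) := by
  have : Nontrivial V := Representation.IsIrreducible.nontrivial_space ρ
  have hone : (1 : V →ₗ[ℂ] V) ≠ 0 := one_ne_zero
  choose c hc using fun x : W =>
    Representation.IsIrreducible.exists_eq_smul_one ρ (ρ (exp x.1)) (hcomm x.1 x.2)
  let χ : AddChar W ℂ :=
    { toFun := c
      map_zero_eq_one' := by
        have h : ρ (exp ((0 : W) : FreeNilpotentLieAlgebra K r 2)) = 1 := map_one ρ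
        rw [hc] at h
        exact smul_left_injective ℂ hone (h.trans (one_smul ℂ _).symm)
      map_add_eq_mul' := fun x y => by
        have h := hadd x.1 x.2 y.1 y.2
        rw [hc, hc y, ← Submodule.coe_add, hc, smul_mul_smul_comm, mul_one] at h
        exact (smul_left_injective ℂ hone h).symm }
  obtain ⟨l, hl⟩ := exists_dual_of_addChar (K := K) χ
  obtain ⟨m, hm⟩ := LinearMap.exists_extend l
  refine ⟨m, fun x hx => ?_⟩
  have h1 : c ⟨x, hx⟩ = stdAddChar K (l ⟨x, hx⟩) := hl ⟨x, hx⟩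
  rw [hc ⟨x, hx⟩, h1, ← hm]
  rfl

/-- Every irreducible representation lies over some functional: its central character determines
an alternating form, and the radical of that form again acts by scalars. -/
theorem exists_liesOver (h2 : (2 : K) ≠ 0) {V : Type*} [AddCommGroup V] [Module ℂ V]
    [FiniteDimensional ℂ V] (ρ : Representation ℂ (FreeNilpotentGroupTwo K r) V)
    [ρ.IsIrreducible] : ∃ m, LiesOver ρ m := by
  let Z : Submodule K (FreeNilpotentLieAlgebra K r 2) :=
    (LieAlgebra.center K (FreeNilpotentLieAlgebra K r 2)).toSubmodule
  have hZ : ∀ x, x ∈ Z ↔ ∀ y : FreeNilpotentLieAlgebra K r 2, ⁅x, y⁆ = 0 := fun x => by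
    change x ∈ LieAlgebra.center K _ ↔ _
    rw [LieModule.mem_maxTrivSubmodule]
    refine forall_congr' fun y => ?_
    rw [← lie_skew, neg_eq_zero]
  have hlieZ : ∀ x y : FreeNilpotentLieAlgebra K r 2, ⁅x, y⁆ ∈ Z := fun x y =>
    (hZ _).2 (lie_lie_eq_zero' x y)
  -- `m₀` gives the central character; only its values on the centre matter
  obtain ⟨m₀, hm₀⟩ := exists_dual_of_commute ρ Z
    (fun x hx g => by
      rw [← map_mul, ← map_mul, show g = exp g.log from rfl, exp_mul_exp_eq_exp_lie_mul h2,
        (hZ x).1 hx, show exp (0 : FreeNilpotentLieAlgebra K r 2) = 1 from rfl, one_mul])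
    (fun x hx y _ => by rw [← map_mul, exp_mul_exp_of_lie_eq_zero ((hZ x).1 hx y)])
  have hlie : ∀ x ∈ radical m₀, ∀ y : FreeNilpotentLieAlgebra K r 2, ∀ t : K,
      ρ (exp (t • ⁅x, y⁆)) = 1 := fun x hx y t => by
    rw [hm₀ _ (Z.smul_mem t (hlieZ x y)), map_smul, hx y, smul_zero, AddChar.map_zero_eq_one,
      one_smul]
  -- brackets with an element of the radical act trivially, so `exp` of the radical acts centrally
  obtain ⟨m, hm⟩ := exists_dual_of_commute ρ (radical m₀)
    (fun x hx g => by
      rw [← map_mul, show g = exp g.log from rfl, exp_mul_exp_eq_exp_lie_mul h2, map_mul,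
        ← one_smul K ⁅x, g.log⁆, hlie x hx, one_mul, map_mul])
    (fun x hx y _ => by
      rw [← map_mul, exp_mul_exp, add_comm (x + y), ← exp_mul_exp_of_lie_eq_zero, map_mul,
        hlie x hx, one_mul]
      rw [smul_lie, lie_lie_eq_zero', smul_zero])
  have : Nontrivial V := Representation.IsIrreducible.nontrivial_space ρ
  have hmm : ∀ z ∈ Z, m z = m₀ z := eqOn_of_stdAddChar_eqOn fun z hz =>
    smul_left_injective ℂ (one_ne_zero (α := V →ₗ[ℂ] V))
      ((hm z (mem_radical_of_forall_lie_eq_zero ((hZ z).1 hz) m₀)).symm.trans (hm₀ z hz))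
  refine ⟨m, fun x hx => hm x ?_⟩
  rwa [radical_congr fun x y => (hmm _ (hlieZ x y)).symm]

/-- Every functional `m` has an irreducible representation over it. It is found in the
representation induced from the linear character `exp x ↦ ψ (m x)` of the radical of `m`, realized
as right translation of functions. -/
theorem exists_isIrreducible_liesOver (h2 : (2 : K) ≠ 0)
    (m : Module.Dual K (FreeNilpotentLieAlgebra K r 2)) :
    ∃ (d : ℕ) (σ : Representation ℂ (FreeNilpotentGroupTwo K r) (Fin d → ℂ)),
      σ.IsIrreducible ∧ LiesOver σ m := by
  classical
  let V : Submodule ℂ (FreeNilpotentGroupTwo K r → ℂ) :=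
    { carrier := {φ | ∀ x ∈ radical m, ∀ g, φ (exp x * g) = stdAddChar K (m x) * φ g}
      zero_mem' := fun x _ g => by simp
      add_mem' := fun {a b} ha hb x hx g => by
        rw [Pi.add_apply, Pi.add_apply, ha x hx, hb x hx, mul_add]
      smul_mem' := fun t a ha x hx g => by
        rw [Pi.smul_apply, Pi.smul_apply, ha x hx, smul_eq_mul, smul_eq_mul, mul_left_comm] }
  let ρ : Representation ℂ (FreeNilpotentGroupTwo K r) V :=
    { toFun := fun h =>
        { toFun := fun φ => ⟨fun g => φ.1 (g * h), fun x hx g => by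
            change φ.1 (exp x * g * h) = _
            rw [mul_assoc]
            exact φ.2 x hx _⟩
          map_add' := fun _ _ => rfl
          map_smul' := fun _ _ => rfl }
      map_one' := LinearMap.ext fun φ => Subtype.ext (funext fun g => congrArg φ.1 (mul_one g))
      map_mul' := fun h k => LinearMap.ext fun φ => Subtype.ext (funext fun g =>
        congrArg φ.1 (mul_assoc g h k).symm) }
  have hρ : LiesOver ρ m := by
    intro x hx
    refine LinearMap.ext fun φ => Subtype.ext (funext fun g => ?_)
    change φ.1 (g * exp x) = stdAddChar K (m x) * φ.1 g
    rw [show g = exp g.log from rfl, exp_mul_exp_eq_exp_lie_mul h2,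
      φ.2 _ (lie_mem_radical m _ _), φ.2 x hx, ← lie_skew, map_neg, hx, neg_zero,
      AddChar.map_zero_eq_one, one_mul]
  -- the extension by zero of the linear character of the radical is a nonzero element
  let φ₀ : FreeNilpotentGroupTwo K r → ℂ := fun g =>
    if g.log ∈ radical m then stdAddChar K (m g.log) else 0
  have hφ₀ : φ₀ ∈ V := by
    intro x hx g
    have hlog : (exp x * g).log = x + g.log + (2⁻¹ : K) • ⁅x, g.log⁆ := rfl
    have hlie := (radical m).smul_mem (2⁻¹ : K) (lie_mem_radical m x g.log)
    have hmem : (exp x * g).log ∈ radical m ↔ g.log ∈ radical m := by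
      rw [hlog, Submodule.add_mem_iff_left _ hlie, Submodule.add_mem_iff_right _ hx]
    simp only [φ₀, hmem]
    split_ifs
    · rw [hlog, map_add, map_smul, hx, smul_zero, add_zero, map_add, AddChar.map_add_eq_mul]
    · rw [mul_zero]
  have : Nontrivial V := by
    refine ⟨⟨φ₀, hφ₀⟩, 0, fun h => ?_⟩
    have h1 : φ₀ 1 = 0 := congrFun (congrArg Subtype.val h) 1
    simp [φ₀, log_one] at h1
  obtain ⟨d, σ, j, hσ, hj, hjσ⟩ := Representation.exists_isIrreducible_intertwining ρ
  refine ⟨d, σ, hσ, fun x hx => LinearMap.ext fun v => hj ?_⟩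
  rw [hjσ, hρ x hx, LinearMap.smul_apply, LinearMap.smul_apply, map_smul, Module.End.one_apply,
    Module.End.one_apply]

variable {V : Type*} [AddCommGroup V] [Module ℂ V]
  {ρ : Representation ℂ (FreeNilpotentGroupTwo K r) V}
  {m : Module.Dual K (FreeNilpotentLieAlgebra K r 2)}

theorem LiesOver.character_of_mem [FiniteDimensional ℂ V] (hρ : LiesOver ρ m)
    {g : FreeNilpotentGroupTwo K r} (hg : g.log ∈ radical m) :
    ρ.character g = Module.finrank ℂ V * stdAddChar K (m g.log) := by
  have h := hρ g.log hg
  rw [show exp g.log = g from rfl] at h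
  rw [Representation.character, h, map_smul, LinearMap.trace_one, smul_eq_mul, mul_comm]

/-- Off the radical the character vanishes, since some conjugate of `g` differs from `g` by an
element acting as a scalar other than `1`. -/
theorem LiesOver.character_of_notMem (h2 : (2 : K) ≠ 0) (hρ : LiesOver ρ m)
    {g : FreeNilpotentGroupTwo K r} (hg : g.log ∉ radical m) : ρ.character g = 0 := by
  rw [mem_radical] at hg
  push Not at hg
  obtain ⟨y, hy⟩ := hg
  obtain ⟨t, ht⟩ : ∃ t, stdAddChar K (t * m ⁅g.log, y⁆) ≠ 1 := by
    by_contra! h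
    exact hy (eq_zero_of_forall_stdAddChar_mul_eq_one h)
  have hgy : g = exp ⁅g.log, t • y⁆ * (exp (t • y) * g * (exp (t • y))⁻¹) := by
    rw [← mul_assoc]
    exact eq_mul_inv_of_mul_eq (exp_mul_exp_eq_exp_lie_mul h2 g.log (t • y))
  have h : ρ.character g = stdAddChar K (t * m ⁅g.log, y⁆) * ρ.character g := by
    conv_lhs => rw [hgy]
    rw [Representation.character, map_mul, hρ _ (lie_mem_radical m _ _), smul_mul_assoc, one_mul,
      map_smul, smul_eq_mul, lie_smul, map_smul, smul_eq_mul]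
    congr 1
    exact ρ.char_conj g (exp (t • y))
  by_contra h0
  exact ht (mul_right_cancel₀ h0 (by rw [one_mul]; exact h.symm))

/-- The degree of an irreducible representation over `m`, from the norm of its character. -/
theorem LiesOver.finrank_sq (h2 : (2 : K) ≠ 0) [FiniteDimensional ℂ V] [ρ.IsIrreducible]
    (hρ : LiesOver ρ m) : Module.finrank ℂ V ^ 2 = Nat.card K ^ (gram m).1.rank := by
  classical
  have := Fintype.ofFinite (FreeNilpotentGroupTwo K r)
  have := Fintype.ofFinite (FreeNilpotentLieAlgebra K r 2)
  have h := Representation.IsIrreducible.sum_character_mul_character_inv ρ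
  have hterm : ∀ g : FreeNilpotentGroupTwo K r, ρ.character g * ρ.character g⁻¹ =
      if g.log ∈ radical m then (Module.finrank ℂ V : ℂ) ^ 2 else 0 := by
    intro g
    split_ifs with hg
    · have hg' : (g⁻¹).log ∈ radical m := by
        rw [log_inv]
        exact (radical m).neg_mem hg
      rw [hρ.character_of_mem hg, hρ.character_of_mem hg', log_inv, map_neg, mul_mul_mul_comm,
        ← AddChar.map_add_eq_mul, add_neg_cancel, AddChar.map_zero_eq_one, mul_one, sq]
    · rw [hρ.character_of_notMem h2 hg, zero_mul]
  simp only [hterm] at h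
  rw [← Finset.sum_filter, Finset.sum_const, nsmul_eq_mul] at h
  have hcard : (Finset.univ.filter fun g : FreeNilpotentGroupTwo K r => g.log ∈ radical m).card =
      Nat.card (radical m) := by
    rw [← Fintype.card_subtype, ← Nat.card_eq_fintype_card]
    exact Nat.card_congr ((logEquiv K r).subtypeEquiv fun g => Iff.rfl)
  rw [hcard, Nat.card_congr (logEquiv K r), Module.natCard_eq_pow_finrank (K := K) (V := radical m),
    Module.natCard_eq_pow_finrank (K := K) (V := FreeNilpotentLieAlgebra K r 2),
    ← finrank_radical_add_rank_gram m, pow_add] at h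
  have hK : 0 < Nat.card K ^ Module.finrank K (radical m) := pow_pos Nat.card_pos _
  exact Nat.eq_of_mul_eq_mul_left hK (by exact_mod_cast h)

theorem LiesOver.finrank_eq (h2 : (2 : K) ≠ 0) [FiniteDimensional ℂ V] [ρ.IsIrreducible]
    (hρ : LiesOver ρ m) : Module.finrank ℂ V = Nat.card K ^ ((gram m).1.rank / 2) := by
  obtain ⟨k, hk⟩ := even_rank_of_mem_alternatingMatrices (gram m).2
  have h := hρ.finrank_sq h2
  rw [hk, ← mul_two, pow_mul] at h
  rw [hk, ← mul_two, Nat.mul_div_cancel _ two_pos]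
  exact Nat.pow_left_injective two_ne_zero h

end Finite

end FreeNilpotentGroupTwo

/-! ### Counting the irreducible characters -/

namespace FreeNilpotentGroupTwo

open FreeNilpotentLieAlgebra

variable {K : Type*} [Field K] [Finite K] {r : ℕ}

open scoped Classical in
/-- The irreducible character attached to a functional `m`: it vanishes off the radical of `m`,
where it equals the degree times `ψ ∘ m`. The degree is `q ^ i` if the alternating form of `m` has
rank `2 i`. -/
noncomputable def kirillovCharacter (m : Module.Dual K (FreeNilpotentLieAlgebra K r 2)) :
    FreeNilpotentGroupTwo K r → ℂ := fun g =>
  if g.log ∈ radical m then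
    ((Nat.card K ^ ((gram m).1.rank / 2) : ℕ) : ℂ) * stdAddChar K (m g.log)
  else 0

theorem LiesOver.character_eq (h2 : (2 : K) ≠ 0) {V : Type*} [AddCommGroup V] [Module ℂ V]
    [FiniteDimensional ℂ V] {ρ : Representation ℂ (FreeNilpotentGroupTwo K r) V}
    [ρ.IsIrreducible] {m : Module.Dual K (FreeNilpotentLieAlgebra K r 2)} (hρ : LiesOver ρ m) :
    ρ.character = kirillovCharacter m := by
  funext g
  unfold kirillovCharacter
  split_ifs with hg
  · rw [hρ.character_of_mem hg, hρ.finrank_eq h2]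
  · exact hρ.character_of_notMem h2 hg

theorem isIrreducibleCharacter_iff (h2 : (2 : K) ≠ 0) (χ : FreeNilpotentGroupTwo K r → ℂ) :
    IsIrreducibleCharacter (FreeNilpotentGroupTwo K r) χ ↔ ∃ m, kirillovCharacter m = χ := by
  constructor
  · rintro ⟨d, ρ, hρ, rfl⟩
    obtain ⟨m, hm⟩ := exists_liesOver h2 ρ
    exact ⟨m, (hm.character_eq h2).symm⟩
  · rintro ⟨m, rfl⟩
    obtain ⟨d, σ, hσ, hm⟩ := exists_isIrreducible_liesOver h2 m
    exact ⟨d, σ, hσ, (hm.character_eq h2).symm⟩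

theorem kirillovCharacter_one (m : Module.Dual K (FreeNilpotentLieAlgebra K r 2)) :
    kirillovCharacter m 1 = ((Nat.card K ^ ((gram m).1.rank / 2) : ℕ) : ℂ) := by
  rw [kirillovCharacter, log_one, if_pos (zero_mem _), map_zero, AddChar.map_zero_eq_one, mul_one]

theorem card_pow_cast_ne_zero (k : ℕ) : ((Nat.card K ^ k : ℕ) : ℂ) ≠ 0 := by
  exact_mod_cast (pow_pos (Nat.card_pos (α := K)) k).ne'

theorem kirillovCharacter_eq_iff {m m' : Module.Dual K (FreeNilpotentLieAlgebra K r 2)} :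
    kirillovCharacter m' = kirillovCharacter m ↔ ∀ x ∈ radical m, m' x = m x := by
  constructor
  · intro h
    have h1 := congrFun h 1
    rw [kirillovCharacter_one, kirillovCharacter_one] at h1
    refine eqOn_of_stdAddChar_eqOn fun x hx => ?_
    have hx' := congrFun h (exp x)
    unfold kirillovCharacter at hx'
    rw [if_pos (show (exp x).log ∈ radical m from hx), h1] at hx'
    split_ifs at hx'
    · exact mul_left_cancel₀ (card_pow_cast_ne_zero _) hx'
    · exact absurd hx'.symm
        (mul_ne_zero (card_pow_cast_ne_zero _) (AddChar.val_isUnit _ _).ne_zero)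
  · intro h
    have hlie : ∀ x y : FreeNilpotentLieAlgebra K r 2, m' ⁅x, y⁆ = m ⁅x, y⁆ := fun x y =>
      h _ (lie_mem_radical m x y)
    funext g
    unfold kirillovCharacter
    rw [radical_congr hlie, gram_congr hlie]
    split_ifs with hg
    · rw [h _ hg]
    · rfl

/-- The functionals with the same character as `m` form a coset of the annihilator of the radical,
which is the coadjoint orbit of `m`. -/
theorem card_kirillovCharacter_eq (m : Module.Dual K (FreeNilpotentLieAlgebra K r 2)) :
    Nat.card {m' : Module.Dual K (FreeNilpotentLieAlgebra K r 2) //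
      kirillovCharacter m' = kirillovCharacter m} = Nat.card K ^ (gram m).1.rank := by
  have e : {m' : Module.Dual K (FreeNilpotentLieAlgebra K r 2) //
      kirillovCharacter m' = kirillovCharacter m} ≃ (radical m).dualAnnihilator :=
    (Equiv.subRight m).subtypeEquiv fun m' => by
      rw [kirillovCharacter_eq_iff, Submodule.mem_dualAnnihilator]
      refine forall₂_congr fun x _ => ?_
      rw [Equiv.subRight_apply, LinearMap.sub_apply, sub_eq_zero]
  have h1 := Subspace.finrank_add_finrank_dualAnnihilator_eq (radical m)
  have h2 := finrank_radical_add_rank_gram m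
  rw [Nat.card_congr e, Module.natCard_eq_pow_finrank (K := K)]
  congr 1
  omega

theorem card_pow_injective : Function.Injective fun k : ℕ => Nat.card K ^ k :=
  Nat.pow_right_injective Finite.one_lt_card

theorem kirillovCharacter_one_eq_iff {m : Module.Dual K (FreeNilpotentLieAlgebra K r 2)} {i : ℕ} :
    kirillovCharacter m 1 = ((Nat.card K ^ i : ℕ) : ℂ) ↔ (gram m).1.rank = 2 * i := by
  rw [kirillovCharacter_one, Nat.cast_inj, card_pow_injective.eq_iff]
  obtain ⟨k, hk⟩ := even_rank_of_mem_alternatingMatrices (gram m).2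
  omega

/-- Each irreducible character of degree `q ^ i` comes from `q ^ (2 i)` of the functionals whose
alternating form has rank `2 i`. -/
theorem ncard_irreducibleCharactersOfDegree_mul (h2 : (2 : K) ≠ 0) (i : ℕ) :
    (irreducibleCharactersOfDegree (FreeNilpotentGroupTwo K r) (Nat.card K ^ i)).ncard *
      Nat.card K ^ (2 * i) = Nat.card K ^ r * numAlternating K r (2 * i) := by
  rw [← card_dual_rank_gram_eq]
  set T := irreducibleCharactersOfDegree (FreeNilpotentGroupTwo K r) (Nat.card K ^ i)
  have : Finite (Module.Dual K (FreeNilpotentLieAlgebra K r 2)) := Module.finite_of_finite K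
  let F : {m : Module.Dual K (FreeNilpotentLieAlgebra K r 2) // (gram m).1.rank = 2 * i} → T :=
    fun m => ⟨kirillovCharacter m.1,
      (isIrreducibleCharacter_iff h2 _).2 ⟨m.1, rfl⟩, kirillovCharacter_one_eq_iff.2 m.2⟩
  have hF : Function.Surjective F := by
    rintro ⟨χ, hχ, h1⟩
    obtain ⟨m, rfl⟩ := (isIrreducibleCharacter_iff h2 χ).1 hχ
    exact ⟨⟨m, kirillovCharacter_one_eq_iff.1 h1⟩, rfl⟩
  have : Finite T := Finite.of_surjective F hF
  have := Fintype.ofFinite T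
  have hfib : ∀ χ : T, Nat.card {m // F m = χ} = Nat.card K ^ (2 * i) := by
    intro χ
    obtain ⟨m, rfl⟩ := hF χ
    have hm := card_kirillovCharacter_eq m.1
    rw [m.2] at hm
    rw [← hm]
    exact Nat.card_congr
      { toFun := fun x => ⟨x.1.1, congrArg Subtype.val x.2⟩
        invFun := fun x => ⟨⟨x.1, by
          rw [← kirillovCharacter_one_eq_iff, x.2, kirillovCharacter_one_eq_iff]
          exact m.2⟩, Subtype.ext x.2⟩ }
  rw [Nat.card_congr (Equiv.sigmaFiberEquiv F).symm, Nat.card_sigma,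
    Finset.sum_congr rfl fun χ _ => hfib χ, Finset.sum_const, smul_eq_mul, Finset.card_univ,
    ← Nat.card_eq_fintype_card, Nat.card_coe_set_eq]

theorem ncard_irreducibleCharactersOfDegree (h2 : (2 : K) ≠ 0) (i : ℕ) :
    ((irreducibleCharactersOfDegree (FreeNilpotentGroupTwo K r) (Nat.card K ^ i)).ncard : ℚ) =
      (Nat.card K : ℚ) ^ ((r : ℤ) + (i : ℤ) ^ 2 - 3 * (i : ℤ)) *
        (∏ j ∈ Finset.range (2 * i), ((Nat.card K : ℚ) ^ (r - j) - 1)) /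
        (∏ j ∈ Finset.range i, ((Nat.card K : ℚ) ^ (2 * (i - j)) - 1)) := by
  have h := congrArg (Nat.cast : ℕ → ℚ) (ncard_irreducibleCharactersOfDegree_mul (r := r) h2 i)
  have hq : (Nat.card K : ℚ) ≠ 0 := by exact_mod_cast (Nat.card_pos (α := K)).ne'
  push_cast at h
  rw [numAlternating_even] at h
  have he : (Nat.card K : ℚ) ^ ((r : ℤ) + (i : ℤ) ^ 2 - 3 * (i : ℤ)) *
      (Nat.card K : ℚ) ^ (2 * i) = (Nat.card K : ℚ) ^ r * (Nat.card K : ℚ) ^ (i * (i - 1)) := by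
    simp only [← zpow_natCast]
    rw [← zpow_add₀ hq, ← zpow_add₀ hq]
    congr 1
    cases i with
    | zero => simp
    | succ i =>
      rw [Nat.add_sub_cancel]
      push_cast
      ring
  refine mul_right_cancel₀ (pow_ne_zero (2 * i) hq) (h.trans ?_)
  rw [div_mul_eq_mul_div, mul_right_comm, he, mul_div_assoc, mul_div_assoc, mul_assoc]

theorem characterDegrees_eq (h2 : (2 : K) ≠ 0) :
    characterDegrees (FreeNilpotentGroupTwo K r) =
      {n : ℕ | ∃ i : ℕ, i ≤ r / 2 ∧ n = Nat.card K ^ i} := by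
  ext n
  constructor
  · rintro ⟨χ, hχ, h1⟩
    obtain ⟨m, rfl⟩ := (isIrreducibleCharacter_iff h2 χ).1 hχ
    rw [kirillovCharacter_one, Nat.cast_inj] at h1
    exact ⟨_, Nat.div_le_div_right (gram m).1.rank_le_width, h1.symm⟩
  · rintro ⟨i, hi, rfl⟩
    have hq : (1 : ℚ) < Nat.card K := by exact_mod_cast Finite.one_lt_card
    apply Set.nonempty_of_ncard_ne_zero
    have hne : ((irreducibleCharactersOfDegree (FreeNilpotentGroupTwo K r)
        (Nat.card K ^ i)).ncard : ℚ) ≠ 0 := by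
      rw [ncard_irreducibleCharactersOfDegree h2]
      refine div_ne_zero (mul_ne_zero (zpow_ne_zero _ (zero_lt_one.trans hq).ne')
        (Finset.prod_ne_zero_iff.2 fun j hj => ?_)) (prod_range_pow_sub_one_ne_zero hq i)
      have := Finset.mem_range.1 hj
      exact (sub_pos.2 (one_lt_pow₀ hq (by omega))).ne'
    exact_mod_cast hne

end FreeNilpotentGroupTwo

theorem two_ne_zero_of_odd_natCard {K : Type*} [Field K] (hK : Odd (Nat.card K)) :
    (2 : K) ≠ 0 := by
  intro h
  have h1 : addOrderOf (1 : K) = 2 :=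
    addOrderOf_eq_prime (by rw [two_nsmul, one_add_one_eq_two, h]) one_ne_zero
  have h3 : 2 ∣ Nat.card K := h1 ▸ addOrderOf_dvd_natCard (1 : K)
  exact (Nat.not_even_iff_odd.2 hK) (even_iff_two_dvd.2 h3)

theorem mainTheorem6 (p f q : ℕ) (hp : p.Prime) (hq : q = p ^ f) (hodd : Odd q)
    (K : Type*) [Field K] (hK : Nat.card K = q) (r : ℕ) (hr : 2 ≤ r) :
    characterDegrees (FreeNilpotentGroupTwo K r) = {n : ℕ | ∃ i : ℕ, i ≤ r / 2 ∧ n = q ^ i} ∧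
    ∀ i : ℕ, 2 * i ≤ r →
      (characterVector p (FreeNilpotentGroupTwo K r) (i * f) : ℚ) =
        (q : ℚ) ^ ((r : ℤ) + (i : ℤ) ^ 2 - 3 * (i : ℤ)) *
          (∏ j ∈ Finset.range (2 * i), ((q : ℚ) ^ (r - j) - 1)) /
          (∏ j ∈ Finset.range i, ((q : ℚ) ^ (2 * (i - j)) - 1)) := by
  subst hK
  have : Finite K := Nat.finite_of_card_ne_zero hodd.pos.ne'
  have h2 : (2 : K) ≠ 0 := two_ne_zero_of_odd_natCard hodd
  refine ⟨FreeNilpotentGroupTwo.characterDegrees_eq h2, fun i _ => ?_⟩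
  rw [characterVector, mul_comm i f, pow_mul, ← hq]
  exact FreeNilpotentGroupTwo.ncard_irreducibleCharactersOfDegree h2 i
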